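/- Let $U$ be a finite totally ordered set and write $[k]=\{0,\dots,k-1\}$. Let $c\ge 1$, $\ell\ge 1$ and $m$ be integers. Let $\mathcal F$ be any nonempty $2$-universal class of functions $U\to[\ell]$, i.e. $\Pr_{g\in\mathcal F}(g(x)=g(y))\le 2/\ell$ for all distinct $x,y\in U$. Let $\mathcal H$ be any nonempty $2$-wise independent class of functions $U\to[m]$, i.e. $\Pr_{f\in\mathcal H}(f(x)=j\wedge f(y)=k)=1/m^2$ for all distinct $x,y\in U$ and all $j,k\in[m]$. All probabilities refer to uniform choice. The class $\mathcal Z^{c,2}_{\ell,m}$ (built from $\mathcal F$ and $\mathcal H$) consists of all pairs $(h_1,h_2)$ given by data $\langle f_1,f_2,g_1,\dots,g_c,z^{(1)},z^{(2)}\rangle$ with $f_i\in\mathcal H$, $g_j\in\mathcal F$ and arbitrary tables $z^{(i)}\colon\{1,\dots,c\}\times[\ell]\to[m]$, where $$h_i(x)=\Bigl(f_i(x)+\sum_{j=1}^{c}z^{(i)}[j,g_j(x)]\Bigr)\bmod m .$$ It carries the uniform distribution on these data. For $T\subseteq U$, let $\mathrm{bad}_T$ be the event that $|T|-\max_{1\le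 j\le c}|g_j(T)|>1$. Let $\mathcal G^2_{m,n}$ be the set of bipartite multigraphs whose two vertex classes are copies of $[m]$ and whose edges carry distinct labels from $\{1,\dots,n\}$. For $S=\{x_1<\dots<x_n\}\subseteq U$, let $G(S,h_1,h_2)\in\mathcal G^2_{m,n}$ be the graph with, for each $i$, an edge labeled $i$ from $h_1(x_i)$ in the first copy to $h_2(x_i)$ in the second copy. For $G\in\mathcal G^2_{m,n}$ let $T(G)=\{x_i\mid G \text{ has an edge labeled } i\}$. For $\mathsf A\subseteq\mathcal G^2_{m,n}$, let $B^{\mathsf A}_S$ be the event that there is a $G\in\mathsf A$ which is a subgraph of $G(S,h_1,h_2)$ (with coinciding edge labels) and for which $\mathrm{bad}_{T(G)}$ occurs. Let $\mathsf{LL}\subseteq\mathcal G^2_{m,n}$ be the set of graphs without leaf edges (edges incident to a vertex of degree $1$), and let $\mathsf{LC}\subseteq\mathcal G^2_{m,n}$ be the set of graphs in which at most one connected component contains a vertex of degree $1$. **Lemma.** For every $\varepsilon>0$ and every integer $c\ge1$ there is a constant $K>0$, depending only on $\varepsilon$ and $c$, such that the following holds for all $U$, $\ell$, $m$, $\mathcal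 F$, $\mathcal H$ as above and all $S\subseteq U$ with $|S|=n$ and $m\ge(1+\varepsilon)n$: if $(h_1,h_2)$ is chosen at random from $\mathcal Z^{c,2}_{\ell,m}$, then $$\Pr\bigl(B^{\mathsf{LL}}_S\bigr)\le\Pr\bigl(B^{\mathsf{LC}}_S\bigr)\le K\cdot\frac{n}{\ell^{c}} .$$ In particular $\Pr(B^{\mathsf{LL}}_S)\le\Pr(B^{\mathsf{LC}}_S)=O(n/\ell^c)$. -/

import Mathlib

/-- Probability of the event `P` under the uniform distribution on the (nonempty) finite set `A`. -/
noncomputable def unifProb {α : Type*} (A : Finset α) (P : α → Prop) : ℝ :=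
  open Classical in ((A.filter P).card : ℝ) / (A.card : ℝ)

/-! ### Hash classes -/

/-- A `b`-universal hash class with functions from `U` to `[m] = {0, …, m - 1}`. -/
def IsUniversalClass {U : Type*} {m : ℕ} (b : ℝ) (H : Finset (U → Fin m)) : Prop :=
  ∀ x y : U, x ≠ y → unifProb H (fun h => h x = h y) ≤ b / (m : ℝ)

/-- A `κ`-wise independent hash class with functions from `U` to `[m]`. -/
def IsWiseIndependentClass {U : Type*} {m : ℕ} (κ : ℕ) (H : Finset (U → Fin m)) : Prop :=
  ∀ x : Fin κ → U, Function.Injective x → ∀ j : Fin κ → Fin m,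
    unifProb H (fun h => ∀ i, h (x i) = j i) = 1 / (m : ℝ) ^ κ

/-- The data `⟨f₁, …, f_d, g₁, …, g_c, z⁽¹⁾, …, z⁽ᵈ⁾⟩` of a sequence of hash functions. The sequence
is treated as a structure from which its components can be read off. -/
structure HashSeq (U : Type*) (c d ℓ m : ℕ) where
  f : Fin d → U → Fin m
  g : Fin c → U → Fin ℓ
  z : Fin d → Fin c → Fin ℓ → Fin m

namespace HashSeq

/-- `h_i(x) = (f_i(x) + ∑_j z⁽ⁱ⁾[j, g_j(x)]) mod m`. -/
def hash {U : Type*} {c d ℓ m : ℕ} (h : HashSeq U c d ℓ m) (i : Fin d) (x : U) : Fin m :=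
  ⟨((h.f i x : ℕ) + ∑ j : Fin c, (h.z i j (h.g j x) : ℕ)) % m,
    Nat.mod_lt _ (Fin.pos (h.f i x))⟩

/-- A hash sequence is the same thing as the triple of its components. -/
def ofTriple (U : Type*) (c d ℓ m : ℕ) :
    ((Fin d → U → Fin m) × (Fin c → U → Fin ℓ) × (Fin d → Fin c → Fin ℓ → Fin m)) ≃
      HashSeq U c d ℓ m where
  toFun p := ⟨p.1, p.2.1, p.2.2⟩
  invFun h := (h.f, h.g, h.z)
  left_inv _ := rfl
  right_inv _ := rfl

/-- The deficiency `d_T = |T| - max_j |g_j(T)|`. Since `|g_j(T)| ≤ |T|`, the subtraction of natural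
numbers is never truncated. -/
def deficiency {U : Type*} {c d ℓ m : ℕ} (h : HashSeq U c d ℓ m) (T : Finset U) : ℕ :=
  T.card - Finset.univ.sup (fun j : Fin c => (T.image (h.g j)).card)

/-- The event `bad_T`. -/
def Bad {U : Type*} {c d ℓ m : ℕ} (h : HashSeq U c d ℓ m) (T : Finset U) : Prop :=
  1 < h.deficiency T

end HashSeq

/-- The hash class `𝒵^{c,d}_{ℓ,m}(F, H)`: all hash sequences with `f_i ∈ H`, `g_j ∈ F` and arbitrary
tables `z⁽ⁱ⁾`. -/
def hashClassZ {U : Type*} {ℓ m : ℕ} (c d : ℕ) (F : Finset (U → Fin ℓ)) (H : Finset (U → Fin m)) :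
    Finset (HashSeq U c d ℓ m) :=
  ((Fintype.piFinset fun _ : Fin d => H) ×ˢ
    ((Fintype.piFinset fun _ : Fin c => F) ×ˢ Finset.univ)).map
      (HashSeq.ofTriple U c d ℓ m).toEmbedding

/-! ### Labeled bipartite multigraphs -/

/-- The set `𝒢²_{m,n}` of bipartite multigraphs whose two vertex classes are copies of `[m]` and
whose edges carry distinct labels from an `n`-element label set. Such a graph assigns to each label
either no edge or an edge `(a, b)` joining `a` in the first copy with `b` in the second copy. -/
abbrev BiGraph (m n : ℕ) : Type := Fin n → Option (Fin m × Fin m)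

namespace BiGraph

variable {m n : ℕ}

/-- The edge labeled `i` is present in `G` and is incident to the vertex `v`. -/
def Inc (G : BiGraph m n) (i : Fin n) (v : Fin m ⊕ Fin m) : Prop :=
  ∃ e : Fin m × Fin m, G i = some e ∧ (v = Sum.inl e.1 ∨ v = Sum.inr e.2)

/-- The degree of a vertex, counted with multiplicity of edges. -/
noncomputable def degree (G : BiGraph m n) (v : Fin m ⊕ Fin m) : ℕ :=
  {i : Fin n | G.Inc i v}.ncard

/-- The edge labeled `i` is incident to a vertex of degree 1. -/
def IsLeafEdge (G : BiGraph m n) (i : Fin n) : Prop :=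
  ∃ v, G.Inc i v ∧ G.degree v = 1

/-- The simple graph obtained by forgetting labels and multiplicities; it has the same connected
components. -/
def toSimple (G : BiGraph m n) : SimpleGraph (Fin m ⊕ Fin m) where
  Adj u v := u ≠ v ∧ ∃ i, G.Inc i u ∧ G.Inc i v
  symm := ⟨fun _ _ h => ⟨h.1.symm, h.2.imp fun _ hi => ⟨hi.2, hi.1⟩⟩⟩
  loopless := ⟨fun _ h => h.1 rfl⟩

/-- `G'` is a subgraph of `G`, with coinciding edge labels. -/
def IsSub (G' G : BiGraph m n) : Prop :=
  ∀ i e, G' i = some e → G i = some e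

/-- The graph property `LL`: there is no leaf edge. -/
def LL (m n : ℕ) : Set (BiGraph m n) :=
  {G | ∀ i, ¬ G.IsLeafEdge i}

/-- The graph property `LC`: at most one connected component has leaves. (Components that are
isolated vertices have no leaves.) -/
def LC (m n : ℕ) : Set (BiGraph m n) :=
  {G | {C : G.toSimple.ConnectedComponent | ∃ v ∈ C.supp, G.degree v = 1}.Subsingleton}

end BiGraph

/-- The graph `G(S, h₁, h₂)`: the key `x_i` of `S = {x_1 < … < x_n}` contributes the edge
`(h₁(x_i), h₂(x_i))` with label `i`. -/
def keyGraph {U : Type*} [LinearOrder U] {m n : ℕ} (S : Finset U) (hS : S.card = n)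
    (h₁ h₂ : U → Fin m) : BiGraph m n :=
  fun i => some (h₁ (S.orderEmbOfFin hS i), h₂ (S.orderEmbOfFin hS i))

/-- The set `T(G)` of the keys `x_i` of `S` such that `G` contains an edge labeled `i`. -/
def keysOf {U : Type*} [LinearOrder U] {m n : ℕ} (S : Finset U) (hS : S.card = n)
    (G : BiGraph m n) : Finset U :=
  (Finset.univ.filter fun i : Fin n => (G i).isSome).map (S.orderEmbOfFin hS).toEmbedding

/-- The event `B^A_S`: some `G ∈ A` is a subgraph of `G(S, h₁, h₂)` and `bad_{T(G)}` occurs. -/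
def FailureEvent {U : Type*} [LinearOrder U] {c ℓ m n : ℕ} (S : Finset U) (hS : S.card = n)
    (A : Set (BiGraph m n)) (h : HashSeq U c 2 ℓ m) : Prop :=
  ∃ G ∈ A, G.IsSub (keyGraph S hS (h.hash 0) (h.hash 1)) ∧ h.Bad (keysOf S hS G)

/-!
If `B^LC_S` occurs, its witness can be oriented so that all non-isolated vertices but one are tails:
a component without leaves has minimum degree at least two, so Hall's theorem matches its vertices
with incident edges, and the edges of the one component with leaves are directed towards a root.
Edges can be deleted one at a time without creating a second sink, and this is repeated until some
`g_j` has no collision after one more deletion. For each `j` follow the successors of two colliding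
edges: the trails obtained end at the exceptional vertex or at a tail met before, and together they
consist of `t` edges on which all `g_j` collide while some `g_j` is injective up to one key.

For fixed keys, the collisions have probability at most `(2 t² / ℓ)^c` by universality. Given
`g_1, …, g_c`, the values of `h_1` and `h_2` on the keys are uniformly distributed, and the `t`
values at the tails determine those at the heads, so the trails occur with probability at most
`m^(-t)`. There are at most `n^t` choices of keys, `m` of the exceptional vertex and
`(2 (t + 1))^(2c)` of the starting sides and ends of the `2c` trails of given lengths. The sum over
all lengths is dominated by `n / ℓ^c` times a convergent series, since `n / m ≤ 1 / (1 + ε)`.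
-/

section SinkFree

variable {E V C : Type*} {tail head : E → V}

/-- In the directed multigraph with edge set `D`, every edge other than those entering `v` is
followed by another edge, so that `v` is the only possible sink. -/
def IsSinkFreeExcept (tail head : E → V) (D : Finset E) (v : V) : Prop :=
  ∀ e ∈ D, head e = v ∨ ∃ e' ∈ D, tail e' = head e

lemma IsSinkFreeExcept.exists_erase [DecidableEq E] {D : Finset E} {v : V}
    (hD : IsSinkFreeExcept tail head D v) (hne : D.Nonempty) :
    ∃ e ∈ D, ∃ v', IsSinkFreeExcept tail head (D.erase e) v' := by
  by_cases hv : ∃ e ∈ D, head e = v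
  · suffices ∃ e ∈ D, IsSinkFreeExcept tail head (D.erase e) v from
      let ⟨e, he, h⟩ := this; ⟨e, he, v, h⟩
    by_contra! hstuck
    -- Each edge is the only successor of some edge not entering `v`; by counting, these
    -- predecessors exhaust `D`.
    have hpred : ∀ e : D, ∃ p : D, head p ≠ v ∧ tail e = head p ∧
        ∀ e' ∈ D, tail e' = head p → e' = e := by
      intro e
      have hsink := hstuck e e.2
      simp only [IsSinkFreeExcept, not_forall, not_or, not_exists, not_and,
        Finset.mem_erase] at hsink
      obtain ⟨p, ⟨-, hp⟩, hpv, honly⟩ := hsink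
      have hunique : ∀ e' ∈ D, tail e' = head p → e' = e := fun e' he' ht =>
        by_contra fun hne => honly e' ⟨hne, he'⟩ ht
      obtain ⟨e', he', ht⟩ := (hD p hp).resolve_left hpv
      exact ⟨⟨p, hp⟩, hpv, hunique e' he' ht ▸ ht, hunique⟩
    choose pred hpredv htail hunique using hpred
    have hinj : Function.Injective pred := fun e e' h =>
      Subtype.ext (hunique e' e e.2 (h ▸ htail e))
    obtain ⟨e, he, rfl⟩ := hv
    obtain ⟨e', he'⟩ := Finite.surjective_of_injective hinj ⟨e, he⟩
    exact hpredv e' (by rw [he'])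
  · obtain ⟨e, he⟩ := hne
    refine ⟨e, he, tail e, fun e' he' => ?_⟩
    have he'D := Finset.mem_of_mem_erase he'
    obtain ⟨e'', he'', ht⟩ := (hD e' he'D).resolve_left fun h => hv ⟨e', he'D, h⟩
    rcases eq_or_ne e'' e with rfl | hne
    · exact Or.inl ht.symm
    · exact Or.inr ⟨e'', Finset.mem_erase.2 ⟨hne, he''⟩, ht⟩

/-- None of the colourings `γ j` is injective, but one of them becomes so when a single index is
deleted: the behaviour of `g₁, …, g_c` on a minimal set of keys on which all of them collide. -/
def IsCritical {I J : Type*} (γ : J → I → C) : Prop :=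
  (∀ j, ¬ Function.Injective (γ j)) ∧ ∃ j a, Set.InjOn (γ j) {a}ᶜ

lemma IsSinkFreeExcept.exists_critical_subset {J : Type*} [Nonempty J] [DecidableEq E]
    {γ : J → E → C} {D : Finset E} {v : V} (hD : IsSinkFreeExcept tail head D v)
    (hcol : ∀ j, ¬ Set.InjOn (γ j) D) :
    ∃ D' v', IsSinkFreeExcept tail head D' v' ∧ (∀ j, ¬ Set.InjOn (γ j) D') ∧
      ∃ j, ∃ e ∈ D', Set.InjOn (γ j) (D'.erase e) := by
  induction D using Finset.strongInduction generalizing v with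
  | H D ih =>
    have hne : D.Nonempty := by
      rw [Finset.nonempty_iff_ne_empty]
      rintro rfl
      exact hcol (Classical.arbitrary J) (by simp)
    obtain ⟨e, he, v', hv'⟩ := hD.exists_erase hne
    by_cases hj : ∃ j, Set.InjOn (γ j) (D.erase e)
    · obtain ⟨j, hj⟩ := hj
      exact ⟨D, v, hD, hcol, j, e, he, hj⟩
    · exact ih _ (Finset.erase_ssubset he) hv' (not_exists.1 hj)

end SinkFree

section Trails

lemma exists_orbit_cover {α ι : Type*} [Finite α] (f : α → α) (w : ι → α) :
    ∃ len : ι → ℕ, Function.Injective (fun p : Σ i, Fin (len i) => f^[p.2] (w p.1)) ∧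
      ∀ i j, ∃ p : Σ i, Fin (len i), f^[p.2] (w p.1) = f^[j] (w i) := by
  classical
  obtain ⟨_, _⟩ := exists_wellFoundedLT ι
  let Stops (i : ι) (j : ℕ) : Prop :=
    (∃ j' < j, f^[j'] (w i) = f^[j] (w i)) ∨ ∃ i' < i, ∃ j', f^[j'] (w i') = f^[j] (w i)
  have hstops : ∀ i, ∃ j, Stops i j := by
    intro i
    obtain ⟨a, b, hne, hab⟩ := Finite.exists_ne_map_eq_of_infinite fun j => f^[j] (w i)
    rcases hne.lt_or_gt with h | h
    · exact ⟨b, Or.inl ⟨a, h, hab⟩⟩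
    · exact ⟨a, Or.inl ⟨b, h, hab.symm⟩⟩
  have hbefore : ∀ {i} (j : Fin (Nat.find (hstops i))), ¬ Stops i j := fun j =>
    Nat.find_min _ j.2
  refine ⟨fun i => Nat.find (hstops i), ?_, fun i => ?_⟩
  · rintro ⟨i, j⟩ ⟨i', j'⟩ h
    rcases lt_trichotomy i i' with hi | rfl | hi
    · exact (hbefore j' (Or.inr ⟨i, hi, j, h⟩)).elim
    · rcases lt_trichotomy j j' with hj | rfl | hj
      · exact (hbefore j' (Or.inl ⟨j, hj, h⟩)).elim
      · rfl
      · exact (hbefore j (Or.inl ⟨j', hj, h.symm⟩)).elim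
    · exact (hbefore j (Or.inr ⟨i', hi, j', h.symm⟩)).elim
  · induction i using WellFoundedLT.induction with
    | ind i ihi =>
      intro j
      induction j using Nat.strong_induction_on with
      | h j ihj =>
        rcases lt_or_ge j (Nat.find (hstops i)) with hj | hj
        · exact ⟨⟨i, j, hj⟩, rfl⟩
        obtain ⟨r, rfl⟩ := Nat.exists_eq_add_of_le' hj
        rcases Nat.find_spec (hstops i) with ⟨j', hj', h⟩ | ⟨i', hi', j', h⟩
        · rw [Function.iterate_add_apply, ← h, ← Function.iterate_add_apply]
          exact ihj _ (by lia)
        · rw [Function.iterate_add_apply, ← h, ← Function.iterate_add_apply]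
          exact ihi i' hi' _

/-- The positions `⟨i, j⟩` on a family of trails, the `i`-th of which has `len i` edges. -/
abbrev TrailIndex {ι : Type*} (len : ι → ℕ) : Type _ := Σ i, Fin (len i)

/-- How a family of alternating trails in a bipartite graph is tied together: the side on which
the `i`-th trail starts, and the position whose tail it runs into at its end (`none` stands for an
exceptional vertex). -/
abbrev TrailPattern {ι : Type*} (len : ι → ℕ) : Type _ :=
  (ι → Fin 2) × (ι → Option (TrailIndex len))

/-- The position following `a` on its trail, or `land i` at the end of the `i`-th trail. -/
def TrailIndex.next {ι : Type*} {len : ι → ℕ} (land : ι → Option (TrailIndex len))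
    (a : TrailIndex len) : Option (TrailIndex len) :=
  if h : a.2 + 1 < len a.1 then some ⟨a.1, a.2 + 1, h⟩ else land a.1

/-- The side of the tail of the edge at position `a`; sides alternate along a trail. -/
def TrailPattern.side {ι : Type*} {len : ι → ℕ} (p : TrailPattern len) (a : TrailIndex len) :
    Fin 2 :=
  p.1 a.1 + (a.2 : ℕ) • 1

lemma IsSinkFreeExcept.exists_succ {E V : Type*} {tail head : E → V} {D : Finset E} {v : V}
    (hD : IsSinkFreeExcept tail head D v) :
    ∃ f : E → E, ∀ e ∈ D, f e ∈ D ∧ (tail (f e) = head e ∨ f e = e ∧ head e = v) := by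
  have hsucc : ∀ e ∈ D, ∃ e', e' ∈ D ∧ (tail e' = head e ∨ e' = e ∧ head e = v) := by
    intro e he
    rcases hD e he with h | ⟨e', he', h⟩
    · exact ⟨e, he, Or.inr ⟨rfl, h⟩⟩
    · exact ⟨e', he', Or.inl h⟩
  choose! f hf using hsucc
  exact ⟨f, hf⟩

lemma IsSinkFreeExcept.exists_trails {E V ι : Type*} [Finite E] {tail head : E → V}
    {D : Finset E} {v : V} (hD : IsSinkFreeExcept tail head D v) {w : ι → E}
    (hw : ∀ i, w i ∈ D) :
    ∃ (len : ι → ℕ) (x : TrailIndex len → E) (land : ι → Option (TrailIndex len)),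
      Function.Injective x ∧ (∀ a, x a ∈ D) ∧ (∀ i, w i ∈ Set.range x) ∧
        ∀ a, head (x a) = (a.next land).elim v fun b => tail (x b) := by
  obtain ⟨f, hf⟩ := hD.exists_succ
  obtain ⟨len, hinj, hcover⟩ := exists_orbit_cover f w
  let x : TrailIndex len → E := fun p => f^[p.2] (w p.1)
  have hmem : ∀ a, x a ∈ D := fun a =>
    Set.MapsTo.iterate (s := (D : Set E)) (fun e he => (hf e he).1) _ (hw a.1)
  have hsucc : ∀ a, ∃ b, x b = f (x a) := fun a =>
    (hcover a.1 (a.2 + 1)).imp fun b hb => hb.trans (Function.iterate_succ_apply' ..)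
  have hland : ∀ i, ∃ o : Option (TrailIndex len), ∀ j : Fin (len i), len i ≤ j + 1 →
      head (x ⟨i, j⟩) = o.elim v fun b => tail (x b) := by
    intro i
    rcases Nat.eq_zero_or_pos (len i) with h0 | hpos
    · exact ⟨none, fun j => absurd j.2 (by lia)⟩
    let last : Fin (len i) := ⟨len i - 1, by lia⟩
    have hlast : ∀ j : Fin (len i), len i ≤ j + 1 → j = last := fun j hj =>
      Fin.ext (by simp only [last]; lia)
    rcases (hf _ (hmem ⟨i, last⟩)).2 with h | h
    · obtain ⟨b, hb⟩ := hsucc ⟨i, last⟩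
      refine ⟨some b, fun j hj => ?_⟩
      rw [hlast j hj, Option.elim_some, hb, h]
    · exact ⟨none, fun j hj => hlast j hj ▸ h.2⟩
  choose land hland using hland
  refine ⟨len, x, land, hinj, hmem, fun i => hcover i 0, fun a => ?_⟩
  unfold TrailIndex.next
  split_ifs with h
  · have hx : x ⟨a.1, a.2 + 1, h⟩ = f (x a) := Function.iterate_succ_apply' ..
    rcases (hf _ (hmem a)).2 with ht | ⟨hfix, -⟩
    · rw [Option.elim_some, hx, ht]
    · exact absurd (congrArg (fun b => (b.2 : ℕ)) (hinj (hx.trans hfix))) (by simp)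
  · exact hland a.1 a.2 (not_lt.1 h)

lemma IsSinkFreeExcept.exists_critical_trails {E V J C : Type*} [Finite E] [Nonempty J]
    {tail head : E → V} {γ : J → E → C} {D : Finset E} {v : V}
    (hD : IsSinkFreeExcept tail head D v) (hcol : ∀ j, ¬ Set.InjOn (γ j) D) :
    ∃ (len : J × Fin 2 → ℕ) (x : TrailIndex len ↪ E) (land : J × Fin 2 → Option (TrailIndex len))
      (v' : V), IsCritical (fun j => γ j ∘ x) ∧
        ∀ a, head (x a) = (a.next land).elim v' fun b => tail (x b) := by
  classical
  obtain ⟨D', v', hD', hcol', j, e, -, hinj⟩ := hD.exists_critical_subset hcol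
  simp only [Set.InjOn, not_forall] at hcol'
  choose e₀ he₀ e₁ he₁ heq hne using hcol'
  have hw : ∀ q : J × Fin 2, ![e₀ q.1, e₁ q.1] q.2 ∈ D' := fun ⟨j, s⟩ => by
    fin_cases s
    exacts [he₀ j, he₁ j]
  obtain ⟨len, x, land, hx, hxD, hrange, hhead⟩ := hD'.exists_trails hw
  have hcollide : ∀ j, ∃ a₀ a₁, x a₀ = e₀ j ∧ x a₁ = e₁ j := fun j =>
    let ⟨a₀, h₀⟩ := hrange (j, 0)
    let ⟨a₁, h₁⟩ := hrange (j, 1)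
    ⟨a₀, a₁, h₀, h₁⟩
  choose a₀ a₁ h₀ h₁ using hcollide
  have hnotinj : ∀ j, ¬ Function.Injective (γ j ∘ x) := fun j h =>
    hne j (by rw [← h₀, ← h₁, h (a₁ := a₀ j) (a₂ := a₁ j) (by simp [h₀, h₁, heq])])
  refine ⟨len, ⟨x, hx⟩, land, v', ⟨hnotinj, j, ?_⟩, hhead⟩
  have herase : ∀ {a}, x a ≠ e → x a ∈ (D'.erase e : Finset E) := fun {a} h =>
    Finset.mem_erase.2 ⟨h, hxD a⟩
  obtain ⟨a, rfl⟩ : e ∈ Set.range x := by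
    by_contra he
    exact hnotinj j fun b b' h =>
      hx (hinj (herase fun h => he ⟨b, h⟩) (herase fun h => he ⟨b', h⟩) h)
  exact ⟨a, fun b hb b' hb' h => hx (hinj (herase (hx.ne hb)) (herase (hx.ne hb')) h)⟩

end Trails

lemma exists_injective_of_card_le_card {α β : Type*} [Finite α] [Finite β] (r : α → β → Prop)
    {k : ℕ} (hk : k ≠ 0) (hα : ∀ a, k ≤ {b | r a b}.ncard) (hβ : ∀ b, {a | r a b}.ncard ≤ k) :
    ∃ φ : α → β, Function.Injective φ ∧ ∀ a, r a (φ a) := by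
  classical
  have := Fintype.ofFinite α
  have := Fintype.ofFinite β
  suffices ∀ A : Finset α, A.card ≤ (A.biUnion fun a => {b | r a b}).card by
    obtain ⟨φ, hφ, hr⟩ := (Finset.all_card_le_biUnion_card_iff_exists_injective _).1 this
    exact ⟨φ, hφ, fun a => by simpa using hr a⟩
  intro A
  refine Nat.le_of_mul_le_mul_right (Finset.card_mul_le_card_mul r (fun a ha => ?_)
    fun b _ => ?_) (Nat.pos_of_ne_zero hk)
  · refine (hα a).trans ?_
    rw [← Set.ncard_coe_finset]
    refine Set.ncard_le_ncard fun b hb => ?_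
    simp only [Finset.coe_bipartiteAbove, Set.mem_ofPred_eq, Finset.mem_biUnion,
      Finset.mem_filter_univ]
    exact ⟨⟨a, ha, hb⟩, hb⟩
  · refine le_trans ?_ (hβ b)
    rw [← Set.ncard_coe_finset]
    exact Set.ncard_le_ncard fun a ha => (Finset.mem_filter.1 ha).2

namespace BiGraph

variable {m n : ℕ} {G : BiGraph m n}

lemma LL_subset_LC : LL m n ⊆ LC m n := by
  rintro G hG C ⟨v, -, hv⟩
  obtain ⟨i, hi⟩ := Set.nonempty_of_ncard_ne_zero (s := {i : Fin n | G.Inc i v})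
    (ne_of_eq_of_ne hv one_ne_zero)
  exact absurd ⟨v, hi, hv⟩ (hG i)

/-- The endpoint of the edge `e` in the copy `s` of `[m]`, so that the two endpoints of `e` are
`endpoint e s` and `endpoint e (s + 1)` for either `s`. -/
def endpoint (e : Fin m × Fin m) (s : Fin 2) : Fin m ⊕ Fin m :=
  ![Sum.inl e.1, Sum.inr e.2] s

lemma side_eq_of_endpoint_eq {e e' : Fin m × Fin m} {s s' : Fin 2}
    (h : endpoint e s = endpoint e' s') : s = s' := by
  fin_cases s <;> fin_cases s' <;> simp [endpoint] at h ⊢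

lemma inc_iff {i : Fin n} {v : Fin m ⊕ Fin m} :
    G.Inc i v ↔ ∃ e, G i = some e ∧ ∃ s, endpoint e s = v := by
  simp only [Inc, endpoint, Fin.exists_fin_two, Matrix.cons_val_zero, Matrix.cons_val_one,
    eq_comm (b := v)]

lemma reachable_of_inc {i : Fin n} {u v : Fin m ⊕ Fin m} (hu : G.Inc i u) (hv : G.Inc i v) :
    G.toSimple.Reachable u v := by
  rcases eq_or_ne u v with rfl | hne
  · rfl
  · exact SimpleGraph.Adj.reachable ⟨hne, i, hu, hv⟩

lemma exists_dist_endpoint_lt {v v₀ : Fin m ⊕ Fin m} (hne : v ≠ v₀)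
    (hr : G.toSimple.Reachable v v₀) :
    ∃ i e s, G i = some e ∧ endpoint e s = v ∧
      G.toSimple.dist (endpoint e (s + 1)) v₀ < G.toSimple.dist v v₀ := by
  obtain ⟨p, hp⟩ := hr.exists_walk_length_eq_dist
  cases p with
  | nil => exact absurd rfl hne
  | @cons _ u _ hadj p =>
    obtain ⟨hvu, i, hv, hu⟩ := hadj
    obtain ⟨e, he, s, rfl⟩ := inc_iff.1 hv
    obtain ⟨e', he', s', rfl⟩ := inc_iff.1 hu
    obtain rfl : e = e' := Option.some_injective _ (he.symm.trans he')
    obtain rfl : s' = s + 1 := by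
      have : s ≠ s' := fun h => hvu (h ▸ rfl)
      lia
    exact ⟨i, e, s, he, rfl, hp ▸ Nat.lt_succ_of_le (SimpleGraph.dist_le p)⟩

lemma exists_injective_inc_of_two_le_degree (G : BiGraph m n) :
    ∃ φ : {v // 2 ≤ G.degree v} → Fin n, Function.Injective φ ∧ ∀ v, G.Inc (φ v) v := by
  refine exists_injective_of_card_le_card
    (fun (v : {v // 2 ≤ G.degree v}) i => G.Inc i v) two_ne_zero (fun v => v.2) fun i => ?_
  rw [← Set.ncard_image_of_injective _ Subtype.val_injective]
  rcases hi : G i with _ | e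
  · simp [Inc, hi]
  · refine (Set.ncard_le_ncard (t := Set.range (endpoint e)) ?_).trans ?_
    · rintro - ⟨v, hv, rfl⟩
      obtain ⟨e', he', s, hs⟩ := inc_iff.1 hv
      exact ⟨s, by rw [← hs, Option.some_injective _ (hi.symm.trans he')]⟩
    · rw [← Set.image_univ]
      exact (Set.ncard_image_le).trans (by simp)

/-- In the component of `v₀`, each edge is assigned to the endpoint farther from `v₀`; elsewhere,
Hall's theorem matches the vertices with incident edges. -/
lemma exists_orientation (G : BiGraph m n) (v₀ : Fin m ⊕ Fin m) :
    ∃ o : Fin n → Fin 2, ∀ v, v ≠ v₀ → (G.toSimple.Reachable v v₀ ∨ 2 ≤ G.degree v) →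
      ∃ i e, G i = some e ∧ endpoint e (o i) = v := by
  obtain ⟨φ, hφ, hinc⟩ := G.exists_injective_inc_of_two_le_degree
  have horient : ∀ i, ∃ s, ∀ e, G i = some e →
      (∀ v, φ v = i → ¬ G.toSimple.Reachable v.1 v₀ → endpoint e s = v) ∧
      (G.toSimple.Reachable (endpoint e s) v₀ →
        G.toSimple.dist (endpoint e (s + 1)) v₀ ≤ G.toSimple.dist (endpoint e s) v₀) := by
    intro i
    by_cases hfar : ∃ v, φ v = i ∧ ¬ G.toSimple.Reachable v.1 v₀
    · obtain ⟨v, rfl, hv⟩ := hfar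
      obtain ⟨e, he, s, hs⟩ := inc_iff.1 (hinc v)
      refine ⟨s, fun e' he' => ?_⟩
      obtain rfl := Option.some_injective _ (he.symm.trans he')
      exact ⟨fun v' hv' _ => hφ hv' ▸ hs, fun h => absurd (hs ▸ h) hv⟩
    · rcases G i with _ | e
      · exact ⟨0, nofun⟩
      obtain ⟨s, hs⟩ : ∃ s, G.toSimple.dist (endpoint e (s + 1)) v₀ ≤
          G.toSimple.dist (endpoint e s) v₀ := Fin.exists_fin_two.2 (le_total _ _)
      refine ⟨s, fun e' he' => ⟨fun v hv hr => (hfar ⟨v, hv, hr⟩).elim, fun _ => ?_⟩⟩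
      exact Option.some_injective _ he' ▸ hs
  choose o ho using horient
  refine ⟨o, fun v hne hv => ?_⟩
  by_cases hr : G.toSimple.Reachable v v₀
  · obtain ⟨i, e, s, he, rfl, hlt⟩ := exists_dist_endpoint_lt hne hr
    refine ⟨i, e, he, by_contra fun h => ?_⟩
    obtain hs : o i = s + 1 := by
      have : o i ≠ s := fun h' => h (by rw [h'])
      lia
    have hr' : G.toSimple.Reachable (endpoint e (o i)) v₀ :=
      (reachable_of_inc (inc_iff.2 ⟨e, he, _, rfl⟩) (inc_iff.2 ⟨e, he, _, rfl⟩)).trans hr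
    have hle := (ho i e he).2 hr'
    rw [hs, show s + 1 + 1 = s by lia] at hle
    exact hle.not_gt hlt
  · have hdeg := hv.resolve_left hr
    obtain ⟨e, he, -⟩ := inc_iff.1 (hinc ⟨v, hdeg⟩)
    exact ⟨_, e, he, (ho _ e he).1 _ rfl hr⟩

lemma exists_orientation_of_mem_LC [NeZero m] (hG : G ∈ LC m n) :
    ∃ (v₀ : Fin m ⊕ Fin m) (o : Fin n → Fin 2), ∀ v, v ≠ v₀ → (∃ i, G.Inc i v) →
      ∃ i e, G i = some e ∧ endpoint e (o i) = v := by
  obtain ⟨v₀, hv₀⟩ : ∃ v₀, ∀ v, G.degree v = 1 → G.toSimple.Reachable v v₀ := by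
    by_cases h : ∃ v₀, G.degree v₀ = 1
    · obtain ⟨v₀, h₀⟩ := h
      exact ⟨v₀, fun v hv => SimpleGraph.ConnectedComponent.exact
        (hG ⟨v, rfl, hv⟩ ⟨v₀, rfl, h₀⟩)⟩
    · exact ⟨Sum.inl 0, fun v hv => absurd ⟨v, hv⟩ h⟩
  obtain ⟨o, ho⟩ := G.exists_orientation v₀
  refine ⟨v₀, o, fun v hne hv => ho v hne (or_iff_not_imp_left.2 fun hr => ?_)⟩
  have h0 : G.degree v ≠ 0 := ((Set.ncard_pos (Set.toFinite _)).2 hv).ne'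
  have h1 : G.degree v ≠ 1 := fun h => hr (hv₀ v h)
  lia

end BiGraph

namespace HashSeq

variable {U : Type*} {c d ℓ m : ℕ}

lemma not_injOn_of_bad {h : HashSeq U c d ℓ m} {T : Finset U} (hbad : h.Bad T) (j : Fin c) :
    ¬ Set.InjOn (h.g j) T := by
  intro hinj
  have hcard := Finset.card_image_of_injOn hinj
  have hle := Finset.le_sup (f := fun j : Fin c => (T.image (h.g j)).card) (Finset.mem_univ j)
  rw [Bad, deficiency] at hbad
  lia

/-- The endpoint in the copy `s` of `[m]` of the edge contributed by the key `x`. -/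
def endpoint (h : HashSeq U c 2 ℓ m) (x : U) (s : Fin 2) : Fin m ⊕ Fin m :=
  BiGraph.endpoint (h.hash 0 x, h.hash 1 x) s

lemma elim_endpoint (h : HashSeq U c 2 ℓ m) (x : U) (s : Fin 2) :
    Sum.elim id id (h.endpoint x s) = h.hash s x := by
  fin_cases s <;> rfl

/-- The keys `y a` sit on trails in the graph of `h` whose edge `a` is traversed from side `σ a` to
side `σ a + 1`, where it meets the tail of the edge `r a` or, if `r a` is `none`, the vertex `w`;
moreover, the keys form a critical set for `g₁, …, g_c`. -/
def IsCriticalTrail {I : Type*} (h : HashSeq U c 2 ℓ m) (y : I → U) (σ : I → Fin 2)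
    (r : I → Option I) (w : Fin m) : Prop :=
  IsCritical (fun j => h.g j ∘ y) ∧
    ∀ a, h.hash (σ a + 1) (y a) = (r a).elim w fun b => h.hash (σ b) (y b)

end HashSeq

section FailureEvent

variable {U : Type*} [LinearOrder U] {c ℓ m n : ℕ} {S : Finset U} {hS : S.card = n}
  {h : HashSeq U c 2 ℓ m}

lemma FailureEvent.exists_isSinkFreeExcept [NeZero m]
    (hfail : FailureEvent S hS (BiGraph.LC m n) h) :
    ∃ (o : Fin n → Fin 2) (D : Finset (Fin n)) (v : Fin m ⊕ Fin m),
      IsSinkFreeExcept (fun i => h.endpoint (S.orderEmbOfFin hS i) (o i))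
        (fun i => h.endpoint (S.orderEmbOfFin hS i) (o i + 1)) D v ∧
      ∀ j, ¬ Set.InjOn (h.g j ∘ S.orderEmbOfFin hS) D := by
  obtain ⟨G, hG, hsub, hbad⟩ := hfail
  obtain ⟨v, o, ho⟩ := BiGraph.exists_orientation_of_mem_LC hG
  have hedge : ∀ i e s, G i = some e →
      BiGraph.endpoint e s = h.endpoint (S.orderEmbOfFin hS i) s := fun i e s he => by
    obtain rfl := Option.some_injective _ (hsub i e he)
    rfl
  refine ⟨o, Finset.univ.filter fun i => (G i).isSome, v, fun i hi => ?_, fun j hinj => ?_⟩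
  · obtain ⟨e, he⟩ := Option.isSome_iff_exists.1 (Finset.mem_filter.1 hi).2
    refine or_iff_not_imp_left.2 fun hv => ?_
    obtain ⟨i', e', he', hi'⟩ := ho _ hv ⟨i, BiGraph.inc_iff.2 ⟨e, he, _, hedge i e _ he⟩⟩
    exact ⟨i', by simp [he'], (hedge i' e' _ he').symm.trans hi'⟩
  · refine HashSeq.not_injOn_of_bad hbad j ?_
    rw [keysOf, Finset.coe_map]
    exact hinj.image_of_comp

lemma FailureEvent.exists_isCriticalTrail [NeZero c] [NeZero m]
    (hfail : FailureEvent S hS (BiGraph.LC m n) h) :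
    ∃ (len : Fin c × Fin 2 → ℕ) (x : TrailIndex len ↪ Fin n) (p : TrailPattern len) (w : Fin m),
      h.IsCriticalTrail (S.orderEmbOfFin hS ∘ x) p.side (TrailIndex.next p.2) w := by
  obtain ⟨o, D, v, hD, hcol⟩ := hfail.exists_isSinkFreeExcept
  obtain ⟨len, x, land, v', hcrit, hhead⟩ := hD.exists_critical_trails hcol
  have halternate : ∀ a b, a.next land = some b → o (x b) = o (x a) + 1 := fun a b hab => by
    have := hhead a
    rw [hab] at this
    exact (BiGraph.side_eq_of_endpoint_eq this).symm
  let p : TrailPattern len := (fun i => if hi : 0 < len i then o (x ⟨i, 0, hi⟩) else 0, land)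
  have hside : ∀ a, p.side a = o (x a) := by
    rintro ⟨i, j, hj⟩
    induction j with
    | zero => simp [TrailPattern.side, p, hj]
    | succ j ih =>
      rw [halternate ⟨i, j, by lia⟩ _ (dif_pos hj), ← ih (by lia)]
      simp only [TrailPattern.side, succ_nsmul, add_assoc]
  refine ⟨len, x, p, Sum.elim id id v', hcrit, fun a => ?_⟩
  have hhash := congrArg (Sum.elim id id) (hhead a)
  rw [h.elim_endpoint] at hhash
  rw [hside, Function.comp_apply, hhash]
  cases a.next land with
  | none => rfl
  | some b => rw [Option.elim_some, Option.elim_some, h.elim_endpoint, hside, Function.comp_apply]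

end FailureEvent

section UnifProb

variable {α β ι : Type*}

lemma unifProb_eq (A : Finset α) (P : α → Prop) [DecidablePred P] :
    unifProb A P = ((A.filter P).card : ℝ) / A.card := by
  unfold unifProb
  congr!

lemma unifProb_nonneg (A : Finset α) (P : α → Prop) : 0 ≤ unifProb A P := by
  unfold unifProb
  positivity

lemma unifProb_eq_zero {A : Finset α} {P : α → Prop} (h : ∀ a ∈ A, ¬ P a) : unifProb A P = 0 := by
  classical
  rw [unifProb_eq, Finset.filter_false_of_mem h, Finset.card_empty, Nat.cast_zero, zero_div]

lemma unifProb_mono {A : Finset α} {P Q : α → Prop} (h : ∀ a ∈ A, P a → Q a) :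
    unifProb A P ≤ unifProb A Q := by
  classical
  rw [unifProb_eq, unifProb_eq]
  gcongr with a ha
  exact h a ha

lemma unifProb_le_sum {A : Finset α} {P : α → Prop} (s : Finset ι) {Q : ι → α → Prop}
    (h : ∀ a ∈ A, P a → ∃ i ∈ s, Q i a) : unifProb A P ≤ ∑ i ∈ s, unifProb A (Q i) := by
  classical
  simp only [unifProb_eq, ← Finset.sum_div]
  gcongr
  refine mod_cast (Finset.card_le_card fun a ha => ?_).trans Finset.card_biUnion_le
  obtain ⟨haA, haP⟩ := Finset.mem_filter.1 ha
  obtain ⟨i, hi, hQ⟩ := h a haA haP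
  exact Finset.mem_biUnion.2 ⟨i, hi, Finset.mem_filter.2 ⟨haA, hQ⟩⟩

lemma unifProb_le_card_mul {A : Finset α} {P : α → Prop} (s : Finset ι) {Q : ι → α → Prop} {p : ℝ}
    (h : ∀ a ∈ A, P a → ∃ i ∈ s, Q i a) (hp : ∀ i ∈ s, unifProb A (Q i) ≤ p) :
    unifProb A P ≤ s.card * p := by
  rw [← nsmul_eq_mul]
  exact (unifProb_le_sum s h).trans (Finset.sum_le_card_nsmul _ _ _ hp)

lemma unifProb_product (A : Finset α) (B : Finset β) (P : α × β → Prop) :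
    unifProb (A ×ˢ B) P = (∑ b ∈ B, unifProb A fun a => P (a, b)) / B.card := by
  classical
  simp only [unifProb_eq, ← Finset.sum_div, Finset.card_product, Finset.card_filter,
    Finset.sum_product_right, Nat.cast_mul, Nat.cast_sum, div_div]

lemma unifProb_product_le {A : Finset α} {B : Finset β} {P : α × β → Prop} {R : β → Prop} {p : ℝ}
    (hPR : ∀ a ∈ A, ∀ b ∈ B, P (a, b) → R b)
    (hp : ∀ b ∈ B, R b → unifProb A (fun a => P (a, b)) ≤ p) :
    unifProb (A ×ˢ B) P ≤ p * unifProb B R := by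
  classical
  rw [unifProb_product, unifProb_eq, ← mul_div_assoc, mul_comm p, ← nsmul_eq_mul]
  gcongr
  rw [← Finset.sum_const, Finset.sum_filter]
  refine Finset.sum_le_sum fun b hb => ?_
  split_ifs with hR
  · exact hp b hb hR
  · exact (unifProb_eq_zero fun a ha h => hR (hPR a ha b hb h)).le

lemma unifProb_product_le_of_forall {A : Finset α} {B : Finset β} {P : α × β → Prop} {p : ℝ}
    (hp₀ : 0 ≤ p) (hp : ∀ b ∈ B, unifProb A (fun a => P (a, b)) ≤ p) :
    unifProb (A ×ˢ B) P ≤ p := by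
  rw [unifProb_product]
  refine div_le_of_le_mul₀ (by positivity) hp₀ ?_
  rw [mul_comm, ← nsmul_eq_mul]
  exact Finset.sum_le_card_nsmul _ _ _ hp

lemma unifProb_piFinset [Fintype ι] [DecidableEq ι] {α : ι → Type*} (A : ∀ i, Finset (α i))
    (P : ∀ i, α i → Prop) :
    unifProb (Fintype.piFinset A) (fun f => ∀ i, P i (f i)) = ∏ i, unifProb (A i) (P i) := by
  classical
  have hfilter : (Fintype.piFinset A).filter (fun f => ∀ i, P i (f i)) =
      Fintype.piFinset fun i => (A i).filter (P i) := by
    ext f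
    simp only [Finset.mem_filter, Fintype.mem_piFinset, forall_and]
  simp only [unifProb_eq, hfilter, Finset.prod_div_distrib, Fintype.card_piFinset, Nat.cast_prod]

lemma unifProb_equiv {A : Finset α} {B : Finset β} (e : α ≃ β) (he : ∀ a, e a ∈ B ↔ a ∈ A)
    (P : β → Prop) : unifProb A (fun a => P (e a)) = unifProb B P := by
  classical
  rw [unifProb_eq, unifProb_eq, Finset.card_bijective e e.bijective fun a => (he a).symm,
    Finset.card_bijective (t := B.filter P) e e.bijective fun a => by
      rw [Finset.mem_filter, Finset.mem_filter, he]]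

lemma unifProb_univ_map_eq {K L : Type*} [AddGroup K] [AddGroup L] [Fintype K] [Fintype L]
    {φ : K →+ L} (hφ : Function.Surjective φ) (y : L) :
    unifProb Finset.univ (fun x => φ x = y) = 1 / Fintype.card L := by
  classical
  have hfiber : ∀ y', (Finset.univ.filter fun x => φ x = y').card =
      (Finset.univ.filter fun x => φ x = y).card := fun y' =>
    AddMonoidHom.card_fiber_eq_of_mem_range φ (hφ y') (hφ y)
  have hcard : (Finset.univ : Finset K).card =
      Fintype.card L * (Finset.univ.filter fun x => φ x = y).card := by
    rw [Finset.card_eq_sum_card_fiberwise fun x _ => Finset.mem_univ (φ x)]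
    simp only [hfiber, Finset.sum_const, Finset.card_univ, smul_eq_mul]
  have hpos : (Finset.univ.filter fun x => φ x = y).card ≠ 0 :=
    Finset.card_ne_zero.2 ((hφ y).imp fun x hx => Finset.mem_filter.2 ⟨Finset.mem_univ x, hx⟩)
  rw [unifProb_eq, hcard, Nat.cast_mul, div_mul_cancel_right₀ (mod_cast hpos), one_div]

end UnifProb

section HashClasses

variable {U : Type*} {ℓ m : ℕ}

lemma IsUniversalClass.unifProb_not_injective_le {b : ℝ} (hb : 0 ≤ b) {F : Finset (U → Fin ℓ)}
    (hF : IsUniversalClass b F) {I : Type*} [Fintype I] {y : I → U} (hy : Function.Injective y) :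
    unifProb F (fun g => ¬ Function.Injective (g ∘ y)) ≤ b * Fintype.card I ^ 2 / ℓ := by
  classical
  have hpair : ∀ q ∈ (Finset.univ : Finset I).offDiag,
      unifProb F (fun g => g (y q.1) = g (y q.2)) ≤ b / ℓ := fun q hq =>
    hF _ _ (hy.ne (Finset.mem_offDiag.1 hq).2.2)
  refine (unifProb_le_card_mul _ (fun g _ hg => ?_) hpair).trans ?_
  · simp only [Function.Injective, not_forall] at hg
    obtain ⟨i, j, hij, hne⟩ := hg
    exact ⟨(i, j), by simpa using hne, hij⟩
  · rw [mul_comm b, mul_div_assoc]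
    gcongr
    rw [Finset.offDiag_card, Finset.card_univ, ← sq]
    exact_mod_cast Nat.sub_le _ _

lemma IsUniversalClass.unifProb_forall_not_injective_le {b : ℝ} (hb : 0 ≤ b)
    {F : Finset (U → Fin ℓ)} (hF : IsUniversalClass b F) {I : Type*} [Fintype I] {y : I → U}
    (hy : Function.Injective y) (c : ℕ) :
    unifProb (Fintype.piFinset fun _ : Fin c => F)
      (fun g => ∀ j, ¬ Function.Injective (g j ∘ y)) ≤ (b * Fintype.card I ^ 2 / ℓ) ^ c := by
  rw [unifProb_piFinset (fun _ => F) fun _ g => ¬ Function.Injective (g ∘ y), Finset.prod_const,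
    Finset.card_univ, Fintype.card_fin]
  exact pow_le_pow_left₀ (unifProb_nonneg _ _) (hF.unifProb_not_injective_le hb hy) c

variable [NeZero m] {H : Finset (U → Fin m)}

lemma IsWiseIndependentClass.unifProb_sub_eq_le (hH : IsWiseIndependentClass 2 H) {x y : U}
    (hxy : x ≠ y) (δ : Fin m) : unifProb H (fun f => f x - f y = δ) ≤ 1 / m := by
  have hvalue : ∀ k ∈ (Finset.univ : Finset (Fin m)),
      unifProb H (fun f => ∀ i : Fin 2, f (![x, y] i) = ![δ + k, k] i) ≤ 1 / (m : ℝ) ^ 2 :=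
    fun k _ => (hH _ (by simpa [Function.Injective, Fin.forall_fin_two] using ⟨hxy, hxy.symm⟩) _).le
  refine (unifProb_le_card_mul _ (fun f _ hf => ⟨f y, Finset.mem_univ _, ?_⟩) hvalue).trans_eq ?_
  · simp [Fin.forall_fin_two, ← hf]
  · rw [Finset.card_univ, Fintype.card_fin]
    field_simp

lemma unifProb_table_eq {I C M : Type*} [Fintype I] [Fintype C] [DecidableEq C] [AddCommGroup M]
    [Fintype M] {γ : I → C} (hγ : Function.Injective γ) (ρ : I → M) :
    unifProb Finset.univ (fun u : C → M => ∀ i, u (γ i) = ρ i) =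
      1 / (Fintype.card M : ℝ) ^ Fintype.card I := by
  classical
  have h := unifProb_univ_map_eq (φ := (LinearMap.funLeft ℤ M γ).toAddMonoidHom)
    (LinearMap.funLeft_surjective_of_injective ℤ M γ hγ) ρ
  simp only [funext_iff, Fintype.card_fun, Nat.cast_pow] at h
  exact h

lemma exists_ne_apply_eq_of_injOn_compl_singleton {α β : Type*} {f : α → β} {a : α}
    (hf : ¬ Function.Injective f) (ha : Set.InjOn f {a}ᶜ) : ∃ b, b ≠ a ∧ f b = f a := by
  simp only [Function.Injective, not_forall] at hf
  obtain ⟨i, j, hij, hne⟩ := hf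
  rcases eq_or_ne i a with rfl | hi
  · exact ⟨j, Ne.symm hne, hij.symm⟩
  · exact ⟨i, hi, by_contra fun hia => hne (ha hi (fun hj => hia (hj ▸ hij)) hij)⟩

variable {I C : Type*} [Fintype I] [Fintype C] [DecidableEq C] {y : I → U}

lemma IsWiseIndependentClass.unifProb_add_table_eq_le (hH : IsWiseIndependentClass 2 H)
    (hy : Function.Injective y) {γ : I → C} {a : I} (hγ : ¬ Function.Injective γ)
    (ha : Set.InjOn γ {a}ᶜ) (ρ : I → Fin m) :
    unifProb (Finset.univ ×ˢ H)
      (fun q : (C → Fin m) × (U → Fin m) => ∀ i, q.2 (y i) + q.1 (γ i) = ρ i) ≤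
        1 / (m : ℝ) ^ Fintype.card I := by
  classical
  obtain ⟨b, hba, hab⟩ := exists_ne_apply_eq_of_injOn_compl_singleton hγ ha
  have hinj : Function.Injective fun i : {i // i ≠ a} => γ i := Set.injOn_iff_injective.1 ha
  have hcard : Fintype.card {i // i ≠ a} + 1 = Fintype.card I := by
    have := Fintype.card_pos_iff.2 ⟨a⟩
    rw [Fintype.card_subtype_compl, Fintype.card_subtype_eq]
    lia
  -- The colliding keys determine the difference of two values of `f`; given `f`, the table must
  -- attain prescribed values at `card I - 1` distinct positions.
  have hdiff : ∀ u ∈ (Finset.univ : Finset (C → Fin m)), ∀ f ∈ H,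
      (∀ i, f (y i) + u (γ i) = ρ i) → f (y b) - f (y a) = ρ b - ρ a := fun u _ f _ h => by
    rw [← h b, ← h a, hab, add_sub_add_right_eq_sub]
  have htable : ∀ f ∈ H, f (y b) - f (y a) = ρ b - ρ a →
      unifProb Finset.univ (fun u : C → Fin m => ∀ i, f (y i) + u (γ i) = ρ i) ≤
        1 / (m : ℝ) ^ Fintype.card {i // i ≠ a} := fun f _ _ => by
    have h := unifProb_table_eq hinj fun i => ρ i - f (y i)
    rw [Fintype.card_fin] at h
    exact (unifProb_mono fun u _ hu (i : {i // i ≠ a}) => eq_sub_of_add_eq' (hu i)).trans h.le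
  calc
    _ ≤ 1 / (m : ℝ) ^ Fintype.card {i // i ≠ a} *
          unifProb H (fun f => f (y b) - f (y a) = ρ b - ρ a) :=
      unifProb_product_le (P := fun q : (C → Fin m) × (U → Fin m) =>
        ∀ i, q.2 (y i) + q.1 (γ i) = ρ i) hdiff htable
    _ ≤ 1 / (m : ℝ) ^ Fintype.card {i // i ≠ a} * (1 / m) := by
      gcongr
      exact hH.unifProb_sub_eq_le (hy.ne hba) _
    _ = 1 / (m : ℝ) ^ Fintype.card I := by rw [← hcard, pow_succ, one_div_mul_one_div]

lemma IsWiseIndependentClass.unifProb_add_sum_table_eq_le {J : Type*} [Fintype J] [DecidableEq J]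
    (hH : IsWiseIndependentClass 2 H) (hy : Function.Injective y) {γ : J → I → C}
    (hγ : IsCritical γ) (ρ : I → Fin m) :
    unifProb (Finset.univ ×ˢ H)
      (fun q : (J → C → Fin m) × (U → Fin m) => ∀ i, q.2 (y i) + ∑ j, q.1 j (γ j i) = ρ i) ≤
        1 / (m : ℝ) ^ Fintype.card I := by
  obtain ⟨hnot, j₀, a, ha⟩ := hγ
  let e : (J → C → Fin m) × (U → Fin m) ≃
      ((C → Fin m) × (U → Fin m)) × ({j // j ≠ j₀} → C → Fin m) :=
    (((Equiv.funSplitAt j₀ _).trans (Equiv.prodComm _ _)).prodCongr (Equiv.refl _)).trans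
      ((Equiv.prodAssoc _ _ _).trans (Equiv.prodComm _ _))
  let P (q : ((C → Fin m) × (U → Fin m)) × ({j // j ≠ j₀} → C → Fin m)) : Prop :=
    ∀ i, q.1.2 (y i) + q.1.1 (γ j₀ i) = ρ i - ∑ j : {j // j ≠ j₀}, q.2 j (γ j i)
  have hP : ∀ q ∈ (Finset.univ : Finset (J → C → Fin m)) ×ˢ H,
      (∀ i, q.2 (y i) + ∑ j, q.1 j (γ j i) = ρ i) → P (e q) := fun q _ hq i => by
    rw [← hq i, Fintype.sum_eq_add_sum_subtype_ne _ j₀, ← add_assoc]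
    exact (add_sub_cancel_right _ _).symm
  refine (unifProb_mono hP).trans ?_
  rw [unifProb_equiv (B := (Finset.univ ×ˢ H) ×ˢ Finset.univ) e fun q => by simp [e]]
  exact unifProb_product_le_of_forall (by positivity) fun z _ =>
    hH.unifProb_add_table_eq_le hy (hnot j₀) ha fun i => ρ i - ∑ j : {j // j ≠ j₀}, z j (γ j i)

end HashClasses

namespace HashSeq

variable {U : Type*} {c d ℓ m : ℕ}

lemma val_sum_fin {ι : Type*} [NeZero m] (s : Finset ι) (v : ι → Fin m) :
    ((∑ j ∈ s, v j : Fin m) : ℕ) = (∑ j ∈ s, (v j : ℕ)) % m := by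
  classical
  induction s using Finset.induction_on with
  | empty => simp
  | insert a s ha ih => rw [Finset.sum_insert ha, Finset.sum_insert ha, Fin.val_add, ih]; simp

lemma hash_eq [NeZero m] (h : HashSeq U c d ℓ m) (i : Fin d) (x : U) :
    h.hash i x = h.f i x + ∑ j, h.z i j (h.g j x) := by
  refine Fin.ext ?_
  rw [Fin.val_add, val_sum_fin, Nat.add_mod_mod]
  rfl

/-- Groups the table and the function `f` of each of the `d` hash functions together, so that these
pairs become independent once `g₁, …, g_c` are fixed. -/
def ofGrouped : ((Fin d → (Fin c → Fin ℓ → Fin m) × (U → Fin m)) × (Fin c → U → Fin ℓ)) ≃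
    HashSeq U c d ℓ m where
  toFun p := ⟨fun i => (p.1 i).2, p.2, fun i => (p.1 i).1⟩
  invFun h := (fun i => (h.z i, h.f i), h.g)
  left_inv _ := rfl
  right_inv _ := rfl

lemma ofGrouped_mem_hashClassZ {F : Finset (U → Fin ℓ)} {H : Finset (U → Fin m)}
    (p : (Fin d → (Fin c → Fin ℓ → Fin m) × (U → Fin m)) × (Fin c → U → Fin ℓ)) :
    ofGrouped p ∈ hashClassZ c d F H ↔
      p ∈ (Fintype.piFinset fun _ => Finset.univ ×ˢ H) ×ˢ Fintype.piFinset fun _ => F := by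
  simp [hashClassZ, ofGrouped, ofTriple]

variable [NeZero m] {H : Finset (U → Fin m)} {I : Type*} [Fintype I] {y : I → U}

lemma unifProb_forall_hash_eq_le (hH : IsWiseIndependentClass 2 H) (hy : Function.Injective y)
    {g : Fin c → U → Fin ℓ} (hg : IsCritical fun j => g j ∘ y) (ρ : Fin d → I → Fin m) :
    unifProb (Fintype.piFinset fun _ : Fin d => Finset.univ ×ˢ H)
      (fun q => ∀ i a, (ofGrouped (q, g)).hash i (y a) = ρ i a) ≤
        (1 / (m : ℝ) ^ Fintype.card I) ^ d := by
  simp only [hash_eq]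
  refine (unifProb_piFinset (fun _ => Finset.univ ×ˢ H)
    fun i (q : (Fin c → Fin ℓ → Fin m) × (U → Fin m)) =>
      ∀ a, q.2 (y a) + ∑ j, q.1 j (g j (y a)) = ρ i a).trans_le ?_
  refine (Finset.prod_le_prod (fun i _ => unifProb_nonneg _ _) fun i _ =>
    hH.unifProb_add_sum_table_eq_le hy hg (ρ i)).trans_eq ?_
  rw [Finset.prod_const, Finset.card_univ, Fintype.card_fin]

/-- The values at the tails determine those at the heads: of the `m ^ (2 * card I)` possible values
of both hash functions on the keys, at most `m ^ card I` are compatible with the trail pattern. -/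
lemma unifProb_isCriticalTrail_le_of_isCritical (hH : IsWiseIndependentClass 2 H)
    (hy : Function.Injective y) {g : Fin c → U → Fin ℓ} (hg : IsCritical fun j => g j ∘ y)
    (σ : I → Fin 2) (r : I → Option I) (w : Fin m) :
    unifProb (Fintype.piFinset fun _ : Fin 2 => Finset.univ ×ˢ H)
      (fun q => (ofGrouped (q, g)).IsCriticalTrail y σ r w) ≤ 1 / (m : ℝ) ^ Fintype.card I := by
  classical
  let ρ (τ : I → Fin m) (s : Fin 2) (a : I) : Fin m := if s = σ a then τ a else (r a).elim w τ
  have hdetermined : ∀ q : Fin 2 → (Fin c → Fin ℓ → Fin m) × (U → Fin m),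
      (ofGrouped (q, g)).IsCriticalTrail y σ r w →
      ∃ τ, ∀ s a, (ofGrouped (q, g)).hash s (y a) = ρ τ s a := fun q hq =>
    ⟨fun a => (ofGrouped (q, g)).hash (σ a) (y a), fun s a => by
      by_cases hs : s = σ a
      · simp only [ρ, hs, if_true]
      · simp only [ρ, hs, if_false, ← hq.2 a]
        congr
        lia⟩
  refine (unifProb_le_card_mul Finset.univ
    (fun q _ hq => (hdetermined q hq).imp fun _ h => ⟨Finset.mem_univ _, h⟩)
    fun τ _ => unifProb_forall_hash_eq_le hH hy hg (ρ τ)).trans_eq ?_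
  rw [Finset.card_univ, Fintype.card_fun, Fintype.card_fin, Nat.cast_pow]
  field_simp

lemma unifProb_isCriticalTrail_le {b : ℝ} (hb : 0 ≤ b) {F : Finset (U → Fin ℓ)}
    (hF : IsUniversalClass b F) (hH : IsWiseIndependentClass 2 H) (hy : Function.Injective y)
    (σ : I → Fin 2) (r : I → Option I) (w : Fin m) :
    unifProb (hashClassZ c 2 F H) (fun h => h.IsCriticalTrail y σ r w) ≤
      1 / (m : ℝ) ^ Fintype.card I * (b * Fintype.card I ^ 2 / ℓ) ^ c := by
  rw [← unifProb_equiv (P := fun h => h.IsCriticalTrail y σ r w) ofGrouped ofGrouped_mem_hashClassZ]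
  refine (unifProb_product_le (P := fun q => (ofGrouped q).IsCriticalTrail y σ r w)
    (R := fun g => IsCritical fun j => g j ∘ y) (fun q _ g _ h => h.1)
    fun g _ hg => unifProb_isCriticalTrail_le_of_isCritical hH hy hg σ r w).trans ?_
  gcongr
  exact (unifProb_mono fun g _ hg => hg.1).trans (hF.unifProb_forall_not_injective_le hb hy c)

end HashSeq

section Counting

lemma card_trailIndex {ι : Type*} [Fintype ι] (len : ι → ℕ) :
    Fintype.card (TrailIndex len) = ∑ i, len i := by
  simp

lemma card_trailPattern {ι : Type*} [Fintype ι] [DecidableEq ι] (len : ι → ℕ) :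
    Fintype.card (TrailPattern len) = (2 * (∑ i, len i + 1)) ^ Fintype.card ι := by
  rw [Fintype.card_prod, Fintype.card_fun, Fintype.card_fun, Fintype.card_option, card_trailIndex,
    Fintype.card_fin, mul_pow]

variable {U : Type*} [LinearOrder U] {c ℓ m n : ℕ} [NeZero m] {b : ℝ} {F : Finset (U → Fin ℓ)}
  {H : Finset (U → Fin m)} {S : Finset U} {hS : S.card = n}

lemma unifProb_exists_isCriticalTrail_le (hb : 0 ≤ b) (hF : IsUniversalClass b F)
    (hH : IsWiseIndependentClass 2 H) (len : Fin c × Fin 2 → ℕ) {t : ℕ} (ht : ∑ i, len i = t) :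
    unifProb (hashClassZ c 2 F H) (fun h => ∃ (x : TrailIndex len ↪ Fin n) (p : TrailPattern len)
        (w : Fin m), h.IsCriticalTrail (S.orderEmbOfFin hS ∘ x) p.side (TrailIndex.next p.2) w) ≤
      (n : ℝ) ^ t * (2 * (t + 1)) ^ (2 * c) * m * (1 / (m : ℝ) ^ t * (b * t ^ 2 / ℓ) ^ c) := by
  have hevent : ∀ q ∈ (Finset.univ : Finset ((TrailIndex len ↪ Fin n) × TrailPattern len × Fin m)),
      unifProb (hashClassZ c 2 F H) (fun h => h.IsCriticalTrail (S.orderEmbOfFin hS ∘ q.1)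
        q.2.1.side (TrailIndex.next q.2.1.2) q.2.2) ≤ 1 / (m : ℝ) ^ t * (b * t ^ 2 / ℓ) ^ c :=
    fun q _ => by
      have := HashSeq.unifProb_isCriticalTrail_le (c := c) hb hF hH
        ((S.orderEmbOfFin hS).injective.comp q.1.injective) q.2.1.side (TrailIndex.next q.2.1.2)
        q.2.2
      rwa [card_trailIndex, ht] at this
  refine (unifProb_le_card_mul _ (fun h _ ⟨x, p, w, hxpw⟩ =>
    ⟨(x, p, w), Finset.mem_univ _, hxpw⟩) hevent).trans ?_
  rw [Finset.card_univ, Fintype.card_prod, Fintype.card_prod, Fintype.card_embedding_eq,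
    card_trailPattern, card_trailIndex, Fintype.card_prod, ht, mul_comm (Fintype.card (Fin c))]
  simp only [Fintype.card_fin]
  push_cast
  rw [← mul_assoc (n.descFactorial t : ℝ)]
  gcongr
  exact_mod_cast Nat.descFactorial_le_pow n t

lemma trail_bound_le_geom {a : ℝ} (ha : 0 < a) (hnm : a * n ≤ m) (hb : 0 ≤ b) (hc : c ≠ 0) (t : ℕ) :
    (n : ℝ) ^ t * (2 * (t + 1)) ^ (2 * c) * m * (1 / (m : ℝ) ^ t * (b * t ^ 2 / ℓ) ^ c) ≤
      a * 4 ^ c * b ^ c * ((t + 1) ^ (4 * c) * a⁻¹ ^ t) * (n / ℓ ^ c) := by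
  have hm : (0 : ℝ) < m := by exact_mod_cast NeZero.pos m
  rcases t with _ | t
  · have : (b * ((0 : ℕ) : ℝ) ^ 2 / ℓ) ^ c = 0 := by simp [hc]
    rw [this, mul_zero, mul_zero]
    positivity
  have hratio : (n : ℝ) / m ≤ a⁻¹ := by
    rwa [div_le_iff₀ hm, inv_mul_eq_div, le_div_iff₀ ha, mul_comm]
  set T : ℝ := ((t + 1 : ℕ) : ℝ)
  calc
    _ = 4 ^ c * b ^ c * ((T + 1) ^ (2 * c) * T ^ (2 * c) * (n / m : ℝ) ^ t) * (n / ℓ ^ c) := by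
      rw [div_pow, div_pow, mul_pow, mul_pow, pow_mul 2, ← pow_mul T, pow_succ (n : ℝ),
        pow_succ (m : ℝ)]
      norm_num
      field_simp
    _ ≤ 4 ^ c * b ^ c * ((T + 1) ^ (2 * c) * (T + 1) ^ (2 * c) * a⁻¹ ^ t) * (n / ℓ ^ c) := by
      gcongr
      linarith
    _ = a * 4 ^ c * b ^ c * ((T + 1) ^ (4 * c) * a⁻¹ ^ (t + 1)) * (n / ℓ ^ c) := by
      rw [← pow_add, ← two_mul, ← mul_assoc 2 2 c, pow_succ a⁻¹]
      field_simp
      norm_num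
      ring

lemma sum_add_one_le_prod_add_one {ι : Type*} (s : Finset ι) (k : ι → ℕ) :
    ∑ i ∈ s, k i + 1 ≤ ∏ i ∈ s, (k i + 1) := by
  classical
  induction s using Finset.induction_on with
  | empty => simp
  | insert i s hi ih =>
    rw [Finset.sum_insert hi, Finset.prod_insert hi]
    have : k i ≤ k i * ∏ j ∈ s, (k j + 1) := Nat.le_mul_of_pos_right _ (by lia)
    lia

lemma sum_piFinset_pow_mul_geom_le {ι : Type*} [Fintype ι] [DecidableEq ι] {q : ℝ} (hq : 0 ≤ q)
    (s : Finset ℕ) (d : ℕ) :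
    ∑ len ∈ Fintype.piFinset fun _ : ι => s,
        (((∑ i, len i : ℕ) : ℝ) + 1) ^ d * q ^ (∑ i, len i) ≤
      (∑ k ∈ s, ((k : ℝ) + 1) ^ d * q ^ k) ^ Fintype.card ι := by
  rw [← Finset.card_univ, ← Finset.prod_const, Finset.prod_univ_sum]
  refine Finset.sum_le_sum fun len _ => ?_
  rw [Finset.prod_mul_distrib, Finset.prod_pow, Finset.prod_pow_eq_pow_sum]
  gcongr
  exact_mod_cast sum_add_one_le_prod_add_one Finset.univ len

lemma exists_sum_pow_mul_geom_le {q : ℝ} (hq₀ : 0 < q) (hq₁ : q < 1) (d : ℕ) :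
    ∃ B : ℝ, 0 < B ∧ ∀ s : Finset ℕ, ∑ k ∈ s, ((k : ℝ) + 1) ^ d * q ^ k ≤ B := by
  have hsum : Summable fun k : ℕ => ((k : ℝ) + 1) ^ d * q ^ k := by
    have hshift := (summable_nat_add_iff (f := fun k : ℕ => (k : ℝ) ^ d * q ^ k) 1).2
      (summable_pow_mul_geometric_of_norm_lt_one d (by rwa [Real.norm_of_nonneg hq₀.le]))
    refine (hshift.mul_left q⁻¹).congr fun k => ?_
    push_cast
    field_simp
    rw [pow_succ']
  refine ⟨∑' k : ℕ, ((k : ℝ) + 1) ^ d * q ^ k, ?_, fun s => hsum.sum_le_tsum s fun k _ => by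
    positivity⟩
  exact hsum.tsum_pos (fun k => by positivity) 0 (by positivity)

lemma unifProb_failureEvent_LC_le [NeZero c] {a : ℝ} (ha : 0 < a) (hnm : a * n ≤ m) (hb : 0 ≤ b)
    (hF : IsUniversalClass b F) (hH : IsWiseIndependentClass 2 H) :
    unifProb (hashClassZ c 2 F H) (FailureEvent S hS (BiGraph.LC m n)) ≤
      a * 4 ^ c * b ^ c *
        (∑ k ∈ Finset.range (n + 1), ((k : ℝ) + 1) ^ (4 * c) * a⁻¹ ^ k) ^ (2 * c) *
          (n / ℓ ^ c) := by
  let lengths := Fintype.piFinset fun _ : Fin c × Fin 2 => Finset.range (n + 1)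
  have hlen : ∀ {len : Fin c × Fin 2 → ℕ}, (TrailIndex len ↪ Fin n) → len ∈ lengths := by
    intro len x
    have hcard := Fintype.card_le_of_embedding x
    rw [card_trailIndex, Fintype.card_fin] at hcard
    exact Fintype.mem_piFinset.2 fun i => Finset.mem_range_succ_iff.2
      ((Finset.single_le_sum (fun _ _ => Nat.zero_le _) (Finset.mem_univ i)).trans hcard)
  calc
    _ ≤ ∑ len ∈ lengths, unifProb (hashClassZ c 2 F H) _ :=
      unifProb_le_sum _ fun h _ hfail =>
        let ⟨len, x, p, w, hxpw⟩ := hfail.exists_isCriticalTrail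
        ⟨len, hlen x, x, p, w, hxpw⟩
    _ ≤ ∑ len ∈ lengths, a * 4 ^ c * b ^ c *
          ((((∑ i, len i : ℕ) : ℝ) + 1) ^ (4 * c) * a⁻¹ ^ (∑ i, len i)) * (n / ℓ ^ c) :=
      Finset.sum_le_sum fun len _ => (unifProb_exists_isCriticalTrail_le hb hF hH len rfl).trans
        (trail_bound_le_geom ha hnm hb (NeZero.ne c) _)
    _ ≤ _ := by
      rw [← Finset.sum_mul, ← Finset.mul_sum]
      gcongr
      refine (sum_piFinset_pow_mul_geom_le (by positivity) _ _).trans_eq ?_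
      rw [Fintype.card_prod, Fintype.card_fin, Fintype.card_fin, mul_comm c]

end Counting

lemma FailureEvent.ne_zero {U : Type*} [LinearOrder U] {c ℓ m n : ℕ} {S : Finset U}
    {hS : S.card = n} {A : Set (BiGraph m n)} {h : HashSeq U c 2 ℓ m}
    (hfail : FailureEvent S hS A h) : n ≠ 0 := by
  rintro rfl
  obtain ⟨G, -, -, hbad⟩ := hfail
  simp [HashSeq.Bad, HashSeq.deficiency, keysOf] at hbad

theorem mainTheorem4_general (ε : ℝ) (hε : 0 < ε) (b : ℝ) (hb : 0 < b) (c : ℕ) (hc : 1 ≤ c) :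
    ∃ K : ℝ, 0 < K ∧
      ∀ (U : Type*) [LinearOrder U] (n m ℓ : ℕ), 1 ≤ ℓ → (1 + ε) * (n : ℝ) ≤ (m : ℝ) →
      ∀ (F : Finset (U → Fin ℓ)) (H : Finset (U → Fin m)), F.Nonempty → H.Nonempty →
        IsUniversalClass b F → IsWiseIndependentClass 2 H →
      ∀ (S : Finset U) (hS : S.card = n),
        unifProb (hashClassZ c 2 F H) (FailureEvent S hS (BiGraph.LL m n)) ≤
            unifProb (hashClassZ c 2 F H) (FailureEvent S hS (BiGraph.LC m n)) ∧
          unifProb (hashClassZ c 2 F H) (FailureEvent S hS (BiGraph.LC m n)) ≤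
            K * ((n : ℝ) / (ℓ : ℝ) ^ c) := by
  have hε₁ : 0 < 1 + ε := by positivity
  have : NeZero c := ⟨by lia⟩
  obtain ⟨B, hB, hsum⟩ := exists_sum_pow_mul_geom_le (inv_pos.2 hε₁)
    (inv_lt_one_of_one_lt₀ (by linarith)) (4 * c)
  refine ⟨(1 + ε) * 4 ^ c * b ^ c * B ^ (2 * c), by positivity, ?_⟩
  intro U _ n m ℓ _ hnm F H _ _ hF hH S hS
  refine ⟨unifProb_mono fun h _ ⟨G, hG, hrest⟩ => ⟨G, BiGraph.LL_subset_LC hG, hrest⟩, ?_⟩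
  rcases eq_or_ne n 0 with hn | hn
  · rw [unifProb_eq_zero fun h _ hfail => hfail.ne_zero hn]
    positivity
  have hn₀ : (0 : ℝ) < n := by positivity
  have : NeZero m := ⟨by rintro rfl; exact hnm.not_gt (by simpa using by positivity)⟩
  refine (unifProb_failureEvent_LC_le hε₁ hnm hb.le hF hH).trans ?_
  gcongr
  exact hsum _

theorem mainTheorem4 (ε : ℝ) (hε : 0 < ε) (c : ℕ) (hc : 1 ≤ c) :
    ∃ K : ℝ, 0 < K ∧
      ∀ (U : Type*) [Fintype U] [LinearOrder U] (n m ℓ : ℕ), 1 ≤ ℓ → (1 + ε) * (n : ℝ) ≤ (m : ℝ) →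
      ∀ (F : Finset (U → Fin ℓ)) (H : Finset (U → Fin m)), F.Nonempty → H.Nonempty →
        IsUniversalClass 2 F → IsWiseIndependentClass 2 H →
      ∀ (S : Finset U) (hS : S.card = n),
        unifProb (hashClassZ c 2 F H) (FailureEvent S hS (BiGraph.LL m n)) ≤
            unifProb (hashClassZ c 2 F H) (FailureEvent S hS (BiGraph.LC m n)) ∧
          unifProb (hashClassZ c 2 F H) (FailureEvent S hS (BiGraph.LC m n)) ≤
            K * ((n : ℝ) / (ℓ : ℝ) ^ c) := by
  obtain ⟨K, hK, h⟩ := mainTheorem4_general ε hε 2 two_pos c hc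
  exact ⟨K, hK, fun U _ => h U⟩
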